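/- Let $\Omega$ be a finite set of cardinality $d$, and let $F \le F' \le \mathrm{Sym}(\Omega)$ be permutation groups with $F$ acting simply transitively on $\Omega$. Suppose that there are $a, b, c \in \Omega$ with $a \neq b$, $\mathrm{St}_{F'}(a) = \mathrm{St}_{F'}(b)$ and $\mathrm{St}_{F'}(a) \neq \mathrm{St}_{F'}(c)$, where $\mathrm{St}_{F'}(x)$ is the stabiliser of $x$ in $F'$. Let $T_d$ be a $d$-regular tree whose edges are coloured by $\Omega$ in such a way that, at every vertex, each colour is the colour of exactly one incident edge. An automorphism $g$ of $T_d$ induces at each vertex $v$ a permutation of $\Omega$, sending the colour of each edge $e$ at $v$ to the colour of the edge $g(e)$ at $g(v)$. Let $G(F,F')$ be the group of all automorphisms of $T_d$ whose induced permutations belong to $F'$ at every vertex and to $F$ at all but finitely many vertices. It acts on the boundary $\partial T_d$, the set of equivalence classes of infinite geodesic rays (two rays being equivalent if they eventually coincide, up to a shift), with the topology generated by the sets of classes of rays passing through a given oriented edge. For $\xi \in \partial T_d$, let $\mathrm{St}^0_{G(F,F')}(\xi)$ be the subgroup of all elements of $G(F,F')$ that fix every point of some open neighbourhood of $\xi$.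 Then there exist $\xi, \eta \in \partial T_d$ such that $\mathrm{St}^0_{G(F,F')}(\xi) \not\cong \mathrm{St}^0_{G(F,F')}(\eta)$. More precisely, $\xi$ and $\eta$ can be chosen so that, in addition, $\mathrm{St}^0_{G(F,F')}(\xi)$ is the direct product of two non-trivial subgroups, while $\mathrm{St}^0_{G(F,F')}(\eta)$ is not. -/

import Mathlib

universe u v

namespace TreeBoundary

variable {V : Type v}

/-- A one-way infinite geodesic in a tree: an infinite path that never repeats a vertex. -/
structure Ray (T : SimpleGraph V) where
  vert : ℕ → V
  adj : ∀ n, T.Adj (vert n) (vert (n + 1))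
  inj : Function.Injective vert

/-- Two rays are equivalent if they coincide from some point on, up to a shift. -/
def raySetoid (T : SimpleGraph V) : Setoid (Ray T) where
  r x y := ∃ m n, ∀ k, x.vert (m + k) = y.vert (n + k)
  iseqv :=
    { refl := fun _ => ⟨0, 0, fun _ => rfl⟩
      symm := fun ⟨m, n, h⟩ => ⟨n, m, fun k => (h k).symm⟩
      trans := by
        rintro x y z ⟨m, n, h⟩ ⟨p, q, h'⟩
        refine ⟨m + p, q + n, fun k => ?_⟩
        have h1 := h (p + k)
        have h2 := h' (n + k)
        rw [show m + p + k = m + (p + k) by omega, show q + n + k = q + (n + k) by omega, h1, ← h2]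
        congr 1
        omega }

/-- The boundary `∂T` of a tree `T`: the set of equivalence classes of rays. -/
def Boundary (T : SimpleGraph V) : Type v := Quotient (raySetoid T)

/-- The boundary point represented by a ray. -/
def Boundary.mk {T : SimpleGraph V} (r : Ray T) : Boundary T := Quotient.mk (raySetoid T) r

/-- The set of boundary points represented by a ray that starts at `v` and whose next vertex
is `w`. -/
def shadow (T : SimpleGraph V) (v w : V) : Set (Boundary T) :=
  {ξ | ∃ r : Ray T, r.vert 0 = v ∧ r.vert 1 = w ∧ Boundary.mk r = ξ}

/-- The usual topology on the boundary of a tree, generated by the shadows of oriented edges. -/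
instance (T : SimpleGraph V) : TopologicalSpace (Boundary T) :=
  TopologicalSpace.generateFrom {U | ∃ v w : V, T.Adj v w ∧ U = shadow T v w}

/-- The image of a ray under an automorphism. -/
def Ray.map {T : SimpleGraph V} (g : T ≃g T) (r : Ray T) : Ray T where
  vert n := g (r.vert n)
  adj n := g.map_adj_iff.mpr (r.adj n)
  inj := g.injective.comp r.inj

/-- The action of the automorphism group of `T` on the boundary of `T`. -/
instance (T : SimpleGraph V) : MulAction (T ≃g T) (Boundary T) where
  smul g := Quotient.map (Ray.map g) (by
    rintro x y ⟨m, n, h⟩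
    exact ⟨m, n, fun k => congrArg g (h k)⟩)
  one_smul ξ := Quotient.inductionOn ξ fun _ => rfl
  mul_smul _ _ ξ := Quotient.inductionOn ξ fun _ => rfl

end TreeBoundary

/-- The neighbourhood stabiliser of `x`: the subgroup of all elements of `G` whose set of fixed
points contains an open neighbourhood of `x`. -/
def neighbourhoodStabiliser (G : Type*) [Group G] {X : Type*} [TopologicalSpace X] [MulAction G X]
    (x : X) : Subgroup G where
  carrier := {g | ∃ U : Set X, IsOpen U ∧ x ∈ U ∧ ∀ y ∈ U, g • y = y}
  one_mem' := ⟨Set.univ, isOpen_univ, Set.mem_univ x, fun y _ => one_smul G y⟩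
  mul_mem' := by
    rintro g h ⟨U, hU, hxU, hg⟩ ⟨W, hW, hxW, hh⟩
    refine ⟨U ∩ W, hU.inter hW, ⟨hxU, hxW⟩, fun y hy => ?_⟩
    rw [mul_smul, hh y hy.2, hg y hy.1]
  inv_mem' := by
    rintro g ⟨U, hU, hxU, hg⟩
    exact ⟨U, hU, hxU, fun y hy => inv_smul_eq_iff.mpr (hg y hy).symm⟩

/-- A group is a non-trivial direct product if it is the internal direct product of two
non-trivial subgroups: both are normal, they intersect trivially, and they generate the group. -/
def IsNontrivialDirectProduct (G : Type*) [Group G] : Prop :=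
  ∃ H K : Subgroup G, H ≠ ⊥ ∧ K ≠ ⊥ ∧ H.Normal ∧ K.Normal ∧ IsCompl H K

/-- `F` acts simply transitively (freely and transitively) on `Ω`. -/
def IsSimplyTransitive {Ω : Type*} (F : Subgroup (Equiv.Perm Ω)) : Prop :=
  ∀ x y : Ω, ∃! f : F, (f : Equiv.Perm Ω) x = y

/-- A legal colouring of the edges of `T` by `Ω`: at every vertex `v`, each colour is the colour of
exactly one edge containing `v`. In particular every vertex of `T` has degree `|Ω|`. -/
structure LegalColouring {V : Type v} (T : SimpleGraph V) (Ω : Type u) where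
  colour : T.EdgeLabeling Ω
  bijective : ∀ v : V, Function.Bijective
    (fun w : T.neighborSet v => colour.get v w w.2)

namespace LegalColouring

variable {V : Type v} {T : SimpleGraph V} {Ω : Type u}

/-- The bijection between the neighbours of `v` and the colours, sending `w` to the colour of the
edge between `v` and `w`. -/
noncomputable def colourAt (c : LegalColouring T Ω) (v : V) : T.neighborSet v ≃ Ω :=
  Equiv.ofBijective _ (c.bijective v)

/-- A tree with a legal colouring by `Ω` is regular of degree `|Ω|`. -/
theorem card_neighborSet (c : LegalColouring T Ω) (v : V) :
    Nat.card (T.neighborSet v) = Nat.card Ω :=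
  Nat.card_congr (c.colourAt v)

/-- The permutation of `Ω` induced by the automorphism `g` at the vertex `v`: it sends the colour of
each edge `e` at `v` to the colour of the edge `g e` at `g v`. -/
noncomputable def localAction (c : LegalColouring T Ω) (g : T ≃g T) (v : V) : Equiv.Perm Ω :=
  (c.colourAt v).symm.trans ((g.mapNeighborSet v).trans (c.colourAt (g v)))

theorem localAction_one (c : LegalColouring T Ω) (v : V) : c.localAction 1 v = 1 := by
  ext x
  exact (c.colourAt v).apply_symm_apply x

theorem localAction_mul (c : LegalColouring T Ω) (g h : T ≃g T) (v : V) :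
    c.localAction (g * h) v = c.localAction g (h v) * c.localAction h v := by
  ext x
  simp only [localAction, Equiv.Perm.mul_apply, Equiv.trans_apply, Equiv.symm_apply_apply]
  rfl

theorem localAction_inv (c : LegalColouring T Ω) (g : T ≃g T) (v : V) :
    c.localAction g⁻¹ v = (c.localAction g (g⁻¹ v))⁻¹ := by
  have h := localAction_mul c g g⁻¹ v
  rw [mul_inv_cancel, localAction_one] at h
  exact eq_inv_of_mul_eq_one_right h.symm

/-- The group `G(F, F')` of all automorphisms of `T` whose induced permutations belong to `F'` at all
vertices and to `F` at all but finitely many vertices. -/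
def almostPrescribed (c : LegalColouring T Ω) (F F' : Subgroup (Equiv.Perm Ω)) :
    Subgroup (T ≃g T) where
  carrier := {g | (∀ v, c.localAction g v ∈ F') ∧ {v | c.localAction g v ∉ F}.Finite}
  one_mem' := by
    simp only [Set.mem_ofPred_eq, localAction_one]
    exact ⟨fun _ => F'.one_mem, by simp [F.one_mem]⟩
  mul_mem' := by
    rintro g h ⟨hg, hgf⟩ ⟨hh, hhf⟩
    refine ⟨fun v => ?_, ?_⟩
    · rw [localAction_mul]
      exact F'.mul_mem (hg _) (hh v)
    · refine ((hgf.preimage h.injective.injOn).union hhf).subset fun v hv => ?_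
      by_contra hcon
      simp only [Set.mem_union, Set.mem_preimage, Set.mem_ofPred_eq, not_or, not_not] at hcon
      refine hv ?_
      rw [localAction_mul]
      exact F.mul_mem hcon.1 hcon.2
  inv_mem' := by
    rintro g ⟨hg, hgf⟩
    refine ⟨fun v => ?_, ?_⟩
    · rw [localAction_inv]
      exact F'.inv_mem (hg _)
    · refine (hgf.preimage (f := (g⁻¹ : T ≃g T)) (g⁻¹ : T ≃g T).injective.injOn).subset
        fun v hv hcon => hv ?_
      rw [localAction_inv]
      exact F.inv_mem hcon

end LegalColouring

/-!
Write `x ~ y` if the colours `x` and `y` have the same stabiliser in `F'`. For an edge with end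
`v` and colour `x`, `κ.branch v x` is the half of the tree beyond that edge. Every element of
`G(F, F')` that fixes all boundary points of a branch fixes the branch itself: the hypotheses yield
at least four colours, and this leaves room for two rays that witness it
(`fixes_branch_of_fixes_shadow`). So the neighbourhood stabiliser of the endpoint of a ray consists
of the elements of `G(F, F')` fixing a branch that contains a tail of the ray
(`mem_neighbourhoodStabiliser_iff`). Elements of `G(F, F')` are obtained by gluing automorphisms
along a vertex (`exists_glue`); as `F` is simply transitive, any `σ ∈ F'` is the local action at
`v` of an element which fixes all branches at `v` in directions fixed by `σ`
(`exists_almostPrescribed`).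

Let `ξ` be the endpoint of a ray with colours `a, b, a, b, …`. As `a ~ b`, an element that fixes an
edge of the ray fixes all of it, so the neighbourhood stabiliser of `ξ` fixes the first edge. It is
the product of its two subgroups supported on the two sides of this edge
(`isNontrivialDirectProduct_neighbourhoodStabiliser`).

Let `η` be the endpoint of a ray `r` with colours `a, c, a, c, …`. As `a` and `c` are separated by
the stabilisers in both directions, the neighbourhood stabiliser `S` of `η` contains elements moving
`r N`, for every `N`. Suppose that `S` is the internal direct product of `H ≠ 1` and `K ≠ 1`. For
each `N`, one of the factors, say `H`, has an element `h` moving `r N`; it moves off itself the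
complement of a branch containing the tail of `r` from some vertex beyond `r N` on. A non-trivial
`k ∈ K` moves some branch `Z` off itself, and `Z` lies in this complement if `N` is large. If `u`
and `t` are supported on `Z`, then the commutators `[h, u] ∈ H` and `[k, t] ∈ K` commute, and they
act on `Z` as `u⁻¹` and `t⁻¹`. Hence `u` and `t` commute (`commute_of_displaced`), although the
elements supported on `Z` form a non-commutative group (`exists_not_commute`).
-/

namespace LegalColouring

variable {V : Type v} {T : SimpleGraph V} {Ω : Type u} (κ : LegalColouring T Ω)

/-! ### Branches of a coloured tree -/

/-- The neighbour of `v` along the edge of colour `x`. -/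
noncomputable def step (v : V) (x : Ω) : V := (κ.colourAt v).symm x

theorem adj_step (v : V) (x : Ω) : T.Adj v (κ.step v x) := ((κ.colourAt v).symm x).2

theorem step_inj {v : V} {x y : Ω} : κ.step v x = κ.step v y ↔ x = y := by
  simp [step, Subtype.val_inj]

theorem step_colourAt (v : V) (w : T.neighborSet v) : κ.step v (κ.colourAt v w) = w := by
  simp [step]

theorem exists_eq_step {v w : V} (h : T.Adj v w) : ∃ x, w = κ.step v x :=
  ⟨κ.colourAt v ⟨w, h⟩, (κ.step_colourAt v ⟨w, h⟩).symm⟩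

@[simp] theorem step_step (v : V) (x : Ω) : κ.step (κ.step v x) x = v := by
  have h := κ.adj_step v x
  have hx : κ.colourAt (κ.step v x) ⟨v, h.symm⟩ = x := by
    have h1 : κ.colourAt v ⟨κ.step v x, h⟩ = x := (κ.colourAt v).apply_symm_apply x
    have h2 : κ.colourAt (κ.step v x) ⟨v, h.symm⟩ = κ.colourAt v ⟨κ.step v x, h⟩ :=
      κ.colour.get_comm ..
    rw [h2, h1]
  have := κ.step_colourAt (κ.step v x) ⟨v, h.symm⟩
  rwa [hx] at this

theorem map_step (g : T ≃g T) (v : V) (x : Ω) :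
    g (κ.step v x) = κ.step (g v) (κ.localAction g v x) := by
  simp only [step, localAction, Equiv.trans_apply, Equiv.symm_apply_apply]
  rfl

theorem localAction_apply_eq {g : T ≃g T} {v : V} {x y : Ω}
    (h : g (κ.step v x) = κ.step (g v) y) : κ.localAction g v x = y := by
  rwa [map_step, step_inj] at h

/-- The connected component containing `κ.step v x` of the tree with the edge of colour `x` at `v`
removed, described as the set of vertices closer to `κ.step v x` than to `v`. -/
def branch (v : V) (x : Ω) : Set V := {w | T.dist (κ.step v x) w < T.dist v w}

theorem mem_branch {v w : V} {x : Ω} :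
    w ∈ κ.branch v x ↔ T.dist (κ.step v x) w < T.dist v w := Iff.rfl

theorem notMem_branch_self (v : V) (x : Ω) : v ∉ κ.branch v x := by
  simp [mem_branch]

theorem step_mem_branch (v : V) (x : Ω) : κ.step v x ∈ κ.branch v x := by
  rw [mem_branch, SimpleGraph.dist_self, SimpleGraph.dist_eq_one_iff_adj.mpr (κ.adj_step v x)]
  exact one_pos

variable {κ}

theorem ne_of_mem_branch {v w : V} {x : Ω} (h : w ∈ κ.branch v x) : w ≠ v := by
  rintro rfl
  exact κ.notMem_branch_self _ _ h

theorem map_mem_branch {v w : V} {x : Ω} (g : T ≃g T) (h : w ∈ κ.branch v x) :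
    g w ∈ κ.branch (g v) (κ.localAction g v x) := by
  have hd : ∀ p q, T.dist (g p) (g q) = T.dist p q := fun p q => by
    simp only [SimpleGraph.dist_eq_sInf]
    congr 1
    ext n
    constructor
    · rintro ⟨w, rfl⟩
      exact ⟨(w.map g.symm.toHom).copy (g.symm_apply_apply p) (g.symm_apply_apply q), by simp⟩
    · rintro ⟨w, rfl⟩
      exact ⟨w.map g.toHom, by simp⟩
  rw [mem_branch, ← map_step, hd, hd]
  exact h

theorem dist_step (hT : T.IsTree) (v w : V) (x : Ω) :
    T.dist v w = T.dist (κ.step v x) w + 1 ∨ T.dist (κ.step v x) w = T.dist v w + 1 := by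
  have := hT.dist_eq_dist_add_one_of_adj w (κ.adj_step v x)
  rwa [T.dist_comm, T.dist_comm (u := w)] at this

theorem dist_of_mem_branch (hT : T.IsTree) {v w : V} {x : Ω} (h : w ∈ κ.branch v x) :
    T.dist v w = T.dist (κ.step v x) w + 1 := by
  rw [mem_branch] at h
  have := κ.dist_step hT v w x
  omega

theorem mem_branch_step_iff (hT : T.IsTree) {v w : V} {x : Ω} :
    w ∈ κ.branch (κ.step v x) x ↔ w ∉ κ.branch v x := by
  rw [mem_branch, mem_branch, step_step]
  have := κ.dist_step hT v w x
  omega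

theorem exists_mem_branch (hT : T.IsTree) {v w : V} (h : w ≠ v) : ∃ x, w ∈ κ.branch v x := by
  obtain ⟨p, hp⟩ := hT.1.exists_walk_length_eq_dist v w
  cases p with
  | nil => exact absurd rfl h
  | cons hadj q =>
    obtain ⟨x, rfl⟩ := κ.exists_eq_step hadj
    refine ⟨x, ?_⟩
    rw [mem_branch, ← hp, SimpleGraph.Walk.length_cons]
    exact Nat.lt_succ_of_le (SimpleGraph.dist_le q)

theorem branch_disjoint (hT : T.IsTree) {v w : V} {x y : Ω} (hx : w ∈ κ.branch v x)
    (hy : w ∈ κ.branch v y) : x = y := by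
  obtain ⟨p, hp⟩ := hT.1.exists_walk_length_eq_dist (κ.step v x) w
  obtain ⟨q, hq⟩ := hT.1.exists_walk_length_eq_dist (κ.step v y) w
  have hp' := SimpleGraph.Walk.isPath_of_length_eq_dist (.cons (κ.adj_step v x) p)
    (by rw [SimpleGraph.Walk.length_cons, hp, dist_of_mem_branch hT hx])
  have hq' := SimpleGraph.Walk.isPath_of_length_eq_dist (.cons (κ.adj_step v y) q)
    (by rw [SimpleGraph.Walk.length_cons, hq, dist_of_mem_branch hT hy])
  have := congrArg SimpleGraph.Walk.snd ((hT.existsUnique_path v w).unique hp' hq')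
  simpa [step_inj] using this

theorem mem_branch_of_adj (hT : T.IsTree) {v w w' : V} {x : Ω} (hw : w ∈ κ.branch v x)
    (h : T.Adj w w') (hw' : w' ≠ v) : w' ∈ κ.branch v x := by
  wlog hlt : T.dist v w' < T.dist v w generalizing w w' x
  · obtain ⟨y, hy⟩ := κ.exists_mem_branch hT hw'
    rcases hT.dist_eq_dist_add_one_of_adj v h with h1 | h1
    · omega
    · have := this hy h.symm (ne_of_mem_branch hw) (by omega)
      rwa [← branch_disjoint hT this hw]
  · obtain ⟨y, hy⟩ := κ.exists_mem_branch hT hw'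
    have h1 := dist_of_mem_branch hT hy
    have h2 : T.dist (κ.step v y) w ≤ T.dist (κ.step v y) w' + 1 := by
      have := hT.1.dist_triangle (u := κ.step v y) (v := w') (w := w)
      rwa [SimpleGraph.dist_eq_one_iff_adj.mpr h.symm] at this
    have h3 : w ∈ κ.branch v y := by
      rw [mem_branch]; omega
    rwa [branch_disjoint hT hw h3]

theorem branch_step_subset (hT : T.IsTree) {v : V} {x y : Ω} (h : y ≠ x) :
    κ.branch (κ.step v x) y ⊆ κ.branch v x := by
  intro w hw
  by_contra hcon
  exact h (branch_disjoint hT hw ((mem_branch_step_iff hT).mpr hcon))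

/-- An automorphism that fixes `v` and moves its neighbour of colour `x` moves every vertex of the
branch at `v` in the direction `x` into another branch. -/
theorem map_notMem_branch (hT : T.IsTree) {g : T ≃g T} {v w : V} {x : Ω} (hv : g v = v)
    (hx : g (κ.step v x) ≠ κ.step v x) (hw : w ∈ κ.branch v x) : g w ∉ κ.branch v x := by
  intro hcon
  have h := map_mem_branch g hw
  rw [hv] at h
  have h2 := branch_disjoint hT h hcon
  apply hx
  rw [map_step, hv, h2]

theorem map_mem_branch_of_fixed {g : T ≃g T} {v w : V} {x : Ω} (hv : g v = v)
    (hx : g (κ.step v x) = κ.step v x) (hw : w ∈ κ.branch v x) : g w ∈ κ.branch v x := by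
  have h := map_mem_branch g hw
  rwa [hv, κ.localAction_apply_eq (y := x) (by rw [hx, hv])] at h

/-! ### Automorphisms glued from their restrictions to branches -/

/-- The map that fixes `v`, and acts as `φ x` on the branch at `v` in the direction `x`. -/
noncomputable def glueFun (hT : T.IsTree) (v : V) (φ : Ω → V → V) (w : V) : V :=
  open Classical in if h : w = v then v else φ (κ.exists_mem_branch hT h).choose w

theorem glueFun_self (hT : T.IsTree) (v : V) (φ : Ω → V → V) : κ.glueFun hT v φ v = v := by
  simp [glueFun]

theorem glueFun_of_mem_branch (hT : T.IsTree) {v w : V} (φ : Ω → V → V) {x : Ω}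
    (h : w ∈ κ.branch v x) : κ.glueFun hT v φ w = φ x w := by
  have hv := ne_of_mem_branch h
  rw [glueFun, dif_neg hv, branch_disjoint hT (κ.exists_mem_branch hT hv).choose_spec h]

theorem glueFun_leftInverse (hT : T.IsTree) {v : V} {φ ψ : Ω → T ≃g T} {σ : Equiv.Perm Ω}
    (hv : ∀ x, φ x v = v) (hσ : ∀ x, κ.localAction (φ x) v x = σ x)
    (hψ : ∀ x, ψ (σ x) = (φ x)⁻¹) :
    Function.LeftInverse (κ.glueFun hT v fun x => ψ x) (κ.glueFun hT v fun x => φ x) := by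
  intro w
  by_cases hw : w = v
  · rw [hw, glueFun_self, glueFun_self]
  · obtain ⟨x, hx⟩ := κ.exists_mem_branch hT hw
    have h1 := map_mem_branch (φ x) hx
    rw [hv, hσ] at h1
    rw [glueFun_of_mem_branch hT _ hx, glueFun_of_mem_branch hT _ h1, hψ]
    exact (φ x).symm_apply_apply w

theorem glueFun_adj (hT : T.IsTree) {v : V} {φ : Ω → T ≃g T} (hv : ∀ x, φ x v = v) {w w' : V}
    (h : T.Adj w w') :
    T.Adj (κ.glueFun hT v (fun x => φ x) w) (κ.glueFun hT v (fun x => φ x) w') := by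
  have key : ∀ {w w'}, T.Adj w w' → w ≠ v →
      T.Adj (κ.glueFun hT v (fun x => φ x) w) (κ.glueFun hT v (fun x => φ x) w') := by
    intro w w' h hw
    obtain ⟨x, hx⟩ := κ.exists_mem_branch hT hw
    rw [glueFun_of_mem_branch hT _ hx]
    have : κ.glueFun hT v (fun x => φ x) w' = φ x w' := by
      by_cases hw' : w' = v
      · rw [hw', glueFun_self, hv]
      · exact glueFun_of_mem_branch hT _ (mem_branch_of_adj hT hx h hw')
    rw [this]
    exact (φ x).map_adj_iff.mpr h
  by_cases hw : w = v
  · exact (key h.symm (by rw [← hw]; exact h.symm.ne)).symm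
  · exact key h hw

/-- Automorphisms `φ x` fixing `v` whose effects on the edges at `v` are compatible with a single
permutation `σ` of the colours can be glued along `v`. -/
theorem exists_glue (hT : T.IsTree) (v : V) (φ : Ω → T ≃g T) (σ : Equiv.Perm Ω)
    (hv : ∀ x, φ x v = v) (hσ : ∀ x, κ.localAction (φ x) v x = σ x) :
    ∃ g : T ≃g T, g v = v ∧ (∀ x, ∀ w ∈ κ.branch v x, g w = φ x w) ∧ κ.localAction g v = σ ∧
      ∀ x, ∀ w ∈ κ.branch v x, κ.localAction g w = κ.localAction (φ x) w := by
  let ψ : Ω → T ≃g T := fun x => (φ (σ.symm x))⁻¹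
  have hψv : ∀ x, ψ x v = v := fun x => by
    have : (φ (σ.symm x)).symm (φ (σ.symm x) v) = v := (φ (σ.symm x)).symm_apply_apply v
    rwa [hv] at this
  have hψσ : ∀ x, κ.localAction (ψ x) v x = σ.symm x := fun x => by
    have h : ∀ z, (φ z)⁻¹ v = v := fun z => by
      have := (φ z).symm_apply_apply v
      rwa [hv] at this
    rw [localAction_inv, h, Equiv.Perm.inv_eq_iff_eq, hσ, Equiv.apply_symm_apply]
  have h1 := glueFun_leftInverse hT (ψ := ψ) hv hσ (fun x => by simp [ψ])
  have h2 := glueFun_leftInverse hT (φ := ψ) (ψ := φ) hψv hψσ (fun x => by simp [ψ])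
  let g : T ≃g T :=
    { toFun := κ.glueFun hT v fun x => φ x
      invFun := κ.glueFun hT v fun x => ψ x
      left_inv := h1
      right_inv := h2
      map_rel_iff' := by
        intro w w'
        refine ⟨fun h => ?_, glueFun_adj hT hv⟩
        have := κ.glueFun_adj hT hψv h
        simp only [Equiv.coe_fn_mk] at this
        rwa [h1, h1] at this }
  have hg : ∀ w, g w = κ.glueFun hT v (fun x => φ x) w := fun _ => rfl
  have hgv : g v = v := glueFun_self hT v fun x => φ x
  have hgb : ∀ x, ∀ w ∈ κ.branch v x, g w = φ x w := fun x w hw =>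
    glueFun_of_mem_branch hT (fun x => φ x) hw
  refine ⟨g, hgv, hgb, ?_, ?_⟩
  · ext x
    apply κ.localAction_apply_eq
    rw [hgb x _ (κ.step_mem_branch v x), map_step, hv, hσ, hgv]
  · intro x w hw
    ext y
    apply κ.localAction_apply_eq
    rw [hgb x w hw, ← map_step]
    by_cases h : κ.step w y = v
    · rw [h, hgv, hv]
    · exact hgb x _ (mem_branch_of_adj hT hw (κ.adj_step w y) h)

/-- The map fixing `v` that carries a path from `v` with colours `x₁, x₂, …` to the path from `v`
with colours `f x₁, f x₂, …`. -/
noncomputable def recolourFun (hT : T.IsTree) (v : V) (f : Ω → Ω) (w : V) : V :=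
  open Classical in
  if h : v = w then v
  else
    let x := (κ.exists_mem_branch hT h).choose
    κ.step (recolourFun hT v f (κ.step w x)) (f x)
termination_by T.dist w v
decreasing_by exact (κ.exists_mem_branch hT h).choose_spec

theorem recolourFun_self (hT : T.IsTree) (v : V) (f : Ω → Ω) : κ.recolourFun hT v f v = v := by
  rw [recolourFun, dif_pos rfl]

theorem recolourFun_of_mem_branch (hT : T.IsTree) {v w : V} (f : Ω → Ω) {x : Ω}
    (h : v ∈ κ.branch w x) :
    κ.recolourFun hT v f w = κ.step (κ.recolourFun hT v f (κ.step w x)) (f x) := by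
  have hv := ne_of_mem_branch h
  rw [recolourFun, dif_neg hv]
  simp only [branch_disjoint hT (κ.exists_mem_branch hT hv).choose_spec h]

theorem recolourFun_step (hT : T.IsTree) (v : V) (f : Ω → Ω) (w : V) (x : Ω) :
    κ.recolourFun hT v f (κ.step w x) = κ.step (κ.recolourFun hT v f w) (f x) := by
  by_cases h : v ∈ κ.branch w x
  · rw [recolourFun_of_mem_branch hT f h, step_step]
  · rw [recolourFun_of_mem_branch hT f ((mem_branch_step_iff hT).mpr h), step_step]

/-- A map that fixes a vertex and preserves colours is the identity. -/
theorem eq_id_of_map_step (hT : T.IsTree) {v : V} {A : V → V} (hv : A v = v)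
    (hA : ∀ w x, A (κ.step w x) = κ.step (A w) x) (w : V) : A w = w := by
  obtain ⟨p⟩ := hT.1.preconnected w v
  induction p with
  | nil => exact hv
  | @cons w _ _ h p ih =>
    obtain ⟨x, rfl⟩ := κ.exists_eq_step h
    have := hA (κ.step w x) x
    rwa [ih hv, step_step] at this

theorem exists_localAction_eq (hT : T.IsTree) (v : V) (f : Equiv.Perm Ω) :
    ∃ g : T ≃g T, g v = v ∧ ∀ w, κ.localAction g w = f := by
  have hinv : ∀ f : Equiv.Perm Ω, Function.LeftInverse (κ.recolourFun hT v f.symm)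
      (κ.recolourFun hT v f) := fun f w => by
    refine κ.eq_id_of_map_step hT
      (A := fun w => κ.recolourFun hT v f.symm (κ.recolourFun hT v f w)) (v := v) ?_ ?_ w
    · simp only [recolourFun_self]
    · intro w x
      simp only [recolourFun_step, Equiv.symm_apply_apply]
  have hadj : ∀ (f : Equiv.Perm Ω) {w w'}, T.Adj w w' →
      T.Adj (κ.recolourFun hT v f w) (κ.recolourFun hT v f w') := by
    intro f w w' h
    obtain ⟨x, rfl⟩ := κ.exists_eq_step h
    rw [recolourFun_step]
    exact κ.adj_step _ _
  refine ⟨{ toFun := κ.recolourFun hT v f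
            invFun := κ.recolourFun hT v f.symm
            left_inv := hinv f
            right_inv := hinv f.symm
            map_rel_iff' := ?_ }, recolourFun_self hT v f, fun w => ?_⟩
  · intro w w'
    refine ⟨fun h => ?_, hadj f⟩
    have := hadj f.symm h
    simp only [Equiv.coe_fn_mk] at this
    rwa [hinv f, hinv f] at this
  · ext x
    exact κ.localAction_apply_eq (recolourFun_step hT v f w x)

/-- Every permutation in `F'` is the local action at `v` of an element of `G(F, F')` that fixes `v`
and all branches at `v` whose direction is fixed by the permutation. Its local action on the branch
in the direction `x` is the unique element of `F` sending `x` to `σ x`. -/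
theorem exists_almostPrescribed (hT : T.IsTree) {F F' : Subgroup (Equiv.Perm Ω)} (hFF' : F ≤ F')
    (hF : IsSimplyTransitive F) (v : V) {σ : Equiv.Perm Ω} (hσ : σ ∈ F') :
    ∃ g ∈ κ.almostPrescribed F F', g v = v ∧ (∀ x, g (κ.step v x) = κ.step v (σ x)) ∧
      ∀ x, σ x = x → ∀ w ∈ κ.branch v x, g w = w := by
  choose f hf hf' using fun x => hF x (σ x)
  choose φ hφv hφ using fun x => κ.exists_localAction_eq hT v (f x : Equiv.Perm Ω)
  obtain ⟨g, hgv, hgb, hgσ, hgl⟩ := κ.exists_glue hT v φ σ hφv (fun x => by rw [hφ, hf])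
  have hloc : ∀ w, w ≠ v → κ.localAction g w ∈ F := fun w hw => by
    obtain ⟨x, hx⟩ := κ.exists_mem_branch hT hw
    rw [hgl x w hx, hφ]
    exact (f x).2
  refine ⟨g, ⟨fun w => ?_, (Set.finite_singleton v).subset fun w hw => ?_⟩, hgv, fun x => ?_,
    fun x hx w hw => ?_⟩
  · by_cases hw : w = v
    · rwa [hw, hgσ]
    · exact hFF' (hloc w hw)
  · by_contra hcon
    exact hw (hloc w hcon)
  · rw [map_step, hgv, hgσ]
  · have h1 : f x = 1 := (hf' x 1 (by simp [hx])).symm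
    rw [hgb x w hw]
    refine eq_id_of_map_step (κ := κ) hT (hφv x) (fun w y => ?_) w
    rw [map_step, hφ, h1]
    rfl

end LegalColouring

/-! ### Rays and the topology of the boundary -/

namespace TreeBoundary

open LegalColouring

variable {V : Type v} {T : SimpleGraph V} {Ω : Type u} {κ : LegalColouring T Ω}

theorem Boundary.mk_eq_mk {r s : Ray T} :
    Boundary.mk r = Boundary.mk s ↔ ∃ m n, ∀ k, r.vert (m + k) = s.vert (n + k) :=
  Quotient.eq

theorem Ray.exists_colours (κ : LegalColouring T Ω) (r : Ray T) :
    ∃ x : ℕ → Ω, ∀ n, r.vert (n + 1) = κ.step (r.vert n) (x n) := by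
  choose x hx using fun n => κ.exists_eq_step (r.adj n)
  exact ⟨x, hx⟩

theorem Ray.colour_ne {r : Ray T} {x : ℕ → Ω} (hx : ∀ n, r.vert (n + 1) = κ.step (r.vert n) (x n))
    (n : ℕ) : x (n + 1) ≠ x n := by
  intro h
  have h2 := hx (n + 1)
  rw [h, hx n, step_step] at h2
  have := r.inj h2
  omega

theorem branch_antitone (hT : T.IsTree) {p : ℕ → V} {x : ℕ → Ω}
    (hx : ∀ n, p (n + 1) = κ.step (p n) (x n)) (hne : ∀ n, x (n + 1) ≠ x n) :
    Antitone fun n => κ.branch (p n) (x n) := by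
  refine antitone_nat_of_succ_le fun n => ?_
  simp only [hx n]
  exact branch_step_subset hT (hne n)

theorem vert_mem_branch (hT : T.IsTree) {p : ℕ → V} {x : ℕ → Ω}
    (hx : ∀ n, p (n + 1) = κ.step (p n) (x n)) (hne : ∀ n, x (n + 1) ≠ x n) {m n : ℕ}
    (h : m < n) : p n ∈ κ.branch (p m) (x m) := by
  obtain ⟨n, rfl⟩ := Nat.exists_eq_succ_of_ne_zero (Nat.ne_zero_of_lt h)
  refine branch_antitone hT hx hne (Nat.le_of_lt_succ h) ?_
  rw [Nat.succ_eq_add_one, hx n]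
  exact κ.step_mem_branch _ _

theorem Ray.branch_antitone (hT : T.IsTree) {r : Ray T} {x : ℕ → Ω}
    (hx : ∀ n, r.vert (n + 1) = κ.step (r.vert n) (x n)) :
    Antitone fun n => κ.branch (r.vert n) (x n) :=
  TreeBoundary.branch_antitone hT hx (Ray.colour_ne hx)

theorem Ray.vert_mem_branch (hT : T.IsTree) {r : Ray T} {x : ℕ → Ω}
    (hx : ∀ n, r.vert (n + 1) = κ.step (r.vert n) (x n)) {m n : ℕ} (h : m < n) :
    r.vert n ∈ κ.branch (r.vert m) (x m) :=
  TreeBoundary.vert_mem_branch hT hx (Ray.colour_ne hx) h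

theorem exists_ray (hT : T.IsTree) (κ : LegalColouring T Ω) (v : V) {x : ℕ → Ω}
    (hne : ∀ n, x (n + 1) ≠ x n) :
    ∃ r : Ray T, r.vert 0 = v ∧ ∀ n, r.vert (n + 1) = κ.step (r.vert n) (x n) := by
  let p : ℕ → V := fun n => Nat.rec v (fun n w => κ.step w (x n)) n
  have hp : ∀ n, p (n + 1) = κ.step (p n) (x n) := fun _ => rfl
  refine ⟨⟨p, fun n => hp n ▸ κ.adj_step _ _, ?_⟩, rfl, hp⟩
  refine Function.Injective.of_lt_imp_ne fun m n h => ?_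
  exact (ne_of_mem_branch (vert_mem_branch hT hp hne h)).symm

theorem exists_alternating_ray (hT : T.IsTree) (κ : LegalColouring T Ω) (v : V) {y z : Ω}
    (h : y ≠ z) : ∃ r : Ray T, r.vert 0 = v ∧
      ∀ n, r.vert (n + 1) = κ.step (r.vert n) (if Even n then y else z) := by
  refine exists_ray hT κ v fun n => ?_
  by_cases hn : Even n <;> simp [hn, Nat.even_add_one, h, h.symm]

/-- Every boundary point is represented by a ray that starts at a given vertex. -/
theorem exists_ray_from (hT : T.IsTree) (κ : LegalColouring T Ω) (r : Ray T) (v : V) :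
    ∃ s : Ray T, s.vert 0 = v ∧ Boundary.mk s = Boundary.mk r := by
  obtain ⟨p⟩ := hT.1.preconnected v (r.vert 0)
  generalize hw : r.vert 0 = w at p
  induction p with
  | nil => exact ⟨r, hw, rfl⟩
  | @cons v u w h p ih =>
    obtain ⟨s, rfl, hs⟩ := ih hw
    obtain ⟨x, hx⟩ := s.exists_colours κ
    obtain ⟨y, rfl⟩ := κ.exists_eq_step h.symm
    by_cases hy : y = x 0
    · refine ⟨⟨fun n => s.vert (n + 1), fun n => s.adj (n + 1), fun m n hmn => ?_⟩, ?_, ?_⟩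
      · exact Nat.succ_injective (s.inj hmn)
      · simp only [hx, hy]
      · rw [← hs, Boundary.mk_eq_mk]
        exact ⟨0, 1, fun k => by simp [add_comm]⟩
    · let x' : ℕ → Ω := fun n => Nat.casesOn n y x
      obtain ⟨t, ht, ht'⟩ := exists_ray hT κ (κ.step (s.vert 0) y) (x := x') (by
        rintro (_ | n)
        · exact fun h => hy h.symm
        · exact Ray.colour_ne hx n)
      refine ⟨t, ht, ?_⟩
      rw [← hs, Boundary.mk_eq_mk]
      refine ⟨1, 0, fun k => ?_⟩
      induction k with
      | zero =>
        have := ht' 0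
        rw [ht] at this
        simpa [x'] using this
      | succ k ihk =>
        rw [zero_add] at ihk ⊢
        rw [← add_assoc, ht', ihk, hx, add_comm]

theorem mk_mem_shadow_iff (hT : T.IsTree) {r : Ray T} {v : V} {x : Ω} :
    Boundary.mk r ∈ shadow T v (κ.step v x) ↔ ∃ J, ∀ j, J ≤ j → r.vert j ∈ κ.branch v x := by
  constructor
  · rintro ⟨s, rfl, hs1, hs⟩
    obtain ⟨m, n, h⟩ := Boundary.mk_eq_mk.mp hs
    obtain ⟨y, hy⟩ := s.exists_colours κ
    have hyx : y 0 = x := by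
      have := hy 0
      rw [zero_add, hs1, step_inj] at this
      exact this.symm
    refine ⟨n + 1, fun j hj => ?_⟩
    obtain ⟨k, rfl⟩ := Nat.exists_eq_add_of_le hj
    rw [add_assoc, ← h, ← hyx]
    exact Ray.vert_mem_branch hT hy (by omega)
  · rintro ⟨J, hJ⟩
    obtain ⟨s, rfl, hs⟩ := exists_ray_from hT κ r v
    obtain ⟨m, n, h⟩ := Boundary.mk_eq_mk.mp hs
    obtain ⟨y, hy⟩ := s.exists_colours κ
    refine ⟨s, rfl, ?_, hs⟩
    have h1 := Ray.vert_mem_branch hT hy (show 0 < m + (J + 1) by omega)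
    rw [h] at h1
    rw [← branch_disjoint hT h1 (hJ _ (by omega))]
    exact hy 0

theorem shadow_antitone (hT : T.IsTree) (κ : LegalColouring T Ω) (r : Ray T) :
    Antitone fun n => shadow T (r.vert n) (r.vert (n + 1)) := by
  obtain ⟨x, hx⟩ := r.exists_colours κ
  intro m n hmn ξ
  induction ξ using Quotient.inductionOn with
  | h s =>
    change Boundary.mk s ∈ shadow T _ _ → Boundary.mk s ∈ shadow T _ _
    simp only [hx]
    rw [mk_mem_shadow_iff hT, mk_mem_shadow_iff hT]
    rintro ⟨J, hJ⟩
    exact ⟨J, fun j hj => Ray.branch_antitone hT hx hmn (hJ j hj)⟩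

/-- The shadows of the edges of a ray form a neighbourhood basis of its endpoint. -/
theorem exists_shadow_subset (hT : T.IsTree) (κ : LegalColouring T Ω) (r : Ray T)
    {U : Set (Boundary T)} (hU : IsOpen U) (hr : Boundary.mk r ∈ U) :
    ∃ N, shadow T (r.vert N) (r.vert (N + 1)) ⊆ U := by
  induction hU with
  | basic U hU =>
    obtain ⟨v, w, -, rfl⟩ := hU
    obtain ⟨s, rfl, rfl, hs⟩ := hr
    obtain ⟨m, n, h⟩ := Boundary.mk_eq_mk.mp hs
    refine ⟨n, ?_⟩
    have h0 := h 0
    rw [add_zero, add_zero] at h0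
    rw [← h 1, ← h0]
    exact shadow_antitone hT κ s (Nat.zero_le m)
  | univ => exact ⟨0, Set.subset_univ _⟩
  | inter U W _ _ ihU ihW =>
    obtain ⟨M, hM⟩ := ihU hr.1
    obtain ⟨N, hN⟩ := ihW hr.2
    exact ⟨max M N, Set.subset_inter
      ((shadow_antitone hT κ r (le_max_left M N)).trans hM)
      ((shadow_antitone hT κ r (le_max_right M N)).trans hN)⟩
  | sUnion S _ ih =>
    obtain ⟨U, hU, hrU⟩ := hr
    obtain ⟨N, hN⟩ := ih U hU hrU
    exact ⟨N, hN.trans (Set.subset_sUnion_of_mem hU)⟩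

theorem Ray.mem_branch_of_ne (hT : T.IsTree) {r : Ray T} {v : V} {x : Ω}
    (h0 : r.vert 0 ∈ κ.branch v x) (hne : ∀ n, r.vert n ≠ v) (n : ℕ) :
    r.vert n ∈ κ.branch v x := by
  induction n with
  | zero => exact h0
  | succ n ih => exact mem_branch_of_adj hT ih (r.adj n) (hne _)

/-- Suppose that `g` moves a vertex `w` of the branch, and take two rays from `w` that start with
different edges, neither of them pointing to `v` or to `g w`. They stay in the branch, so each is
equivalent to its image under `g`, and this image must leave `g w` along the first edge towards `w`.
Thus `g` sends both starting edges to the same edge. -/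
theorem fixes_branch_of_fixes_shadow (hT : T.IsTree)
    (hΩ : ∀ y z : Ω, ∃ y₁ y₂, y₁ ≠ y₂ ∧ y₁ ≠ y ∧ y₁ ≠ z ∧ y₂ ≠ y ∧ y₂ ≠ z) {g : T ≃g T} {v : V}
    {x : Ω} (hg : ∀ ξ ∈ shadow T v (κ.step v x), g • ξ = ξ) {w : V} (hw : w ∈ κ.branch v x) :
    g w = w := by
  by_contra hgw
  obtain ⟨y, hy⟩ := κ.exists_mem_branch hT (ne_of_mem_branch hw).symm
  obtain ⟨z, hz⟩ := κ.exists_mem_branch hT hgw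
  obtain ⟨q, hq⟩ := κ.exists_mem_branch hT (Ne.symm hgw)
  obtain ⟨y₁, y₂, h12, h1y, h1z, h2y, h2z⟩ := hΩ y z
  have key : ∀ y' z', y' ≠ z' → y' ≠ y → y' ≠ z → κ.localAction g w y' = q := by
    intro y' z' hyz hy' hz'
    obtain ⟨s, rfl, hs⟩ := exists_alternating_ray hT κ w hyz
    have hsb : ∀ j, 0 < j → s.vert j ∈ κ.branch (s.vert 0) y' := fun j hj =>
      Ray.vert_mem_branch hT hs hj
    have hne : ∀ {u t}, u ∈ κ.branch (s.vert 0) t → y' ≠ t → ∀ j, s.vert j ≠ u := by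
      rintro u t hu ht j rfl
      rcases Nat.eq_zero_or_pos j with rfl | hj
      · exact κ.notMem_branch_self _ _ hu
      · exact ht (branch_disjoint hT (hsb j hj) hu)
    have hsv := Ray.mem_branch_of_ne hT hw (hne hy hy')
    have hsg := Ray.mem_branch_of_ne hT hq (hne hz hz')
    obtain ⟨m, n, h⟩ := Boundary.mk_eq_mk.mp
      (hg (Boundary.mk s) ((mk_mem_shadow_iff hT).mpr ⟨0, fun j _ => hsv j⟩))
    have h1 := h 1
    change g (s.vert (m + 1)) = _ at h1
    have h2 := map_mem_branch g (hsb (m + 1) (by omega))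
    rw [h1] at h2
    exact branch_disjoint hT h2 (hsg _)
  exact h12 ((κ.localAction g w).injective
    ((key y₁ y₂ h12 h1y h1z).trans (key y₂ y₁ h12.symm h2y h2z).symm))

theorem fixes_shadow_of_fixes_branch (hT : T.IsTree) {g : T ≃g T} {v : V} {x : Ω}
    (hg : ∀ w ∈ κ.branch v x, g w = w) {ξ : Boundary T} (hξ : ξ ∈ shadow T v (κ.step v x)) :
    g • ξ = ξ := by
  induction ξ using Quotient.inductionOn with
  | h s =>
    obtain ⟨J, hJ⟩ := (mk_mem_shadow_iff hT).mp hξ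
    exact Boundary.mk_eq_mk.mpr ⟨J, J, fun k => hg _ (hJ _ (by omega))⟩

/-- The neighbourhood stabiliser of the endpoint of a ray consists of the elements that fix a
branch containing a tail of the ray. -/
theorem mem_neighbourhoodStabiliser_iff (hT : T.IsTree)
    (hΩ : ∀ y z : Ω, ∃ y₁ y₂, y₁ ≠ y₂ ∧ y₁ ≠ y ∧ y₁ ≠ z ∧ y₂ ≠ y ∧ y₂ ≠ z)
    {G : Subgroup (T ≃g T)} {r : Ray T} {x : ℕ → Ω}
    (hx : ∀ n, r.vert (n + 1) = κ.step (r.vert n) (x n)) {g : G} :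
    g ∈ neighbourhoodStabiliser G (Boundary.mk r) ↔
      ∃ N, ∀ w ∈ κ.branch (r.vert N) (x N), (g : T ≃g T) w = w := by
  constructor
  · rintro ⟨U, hU, hrU, hg⟩
    obtain ⟨N, hN⟩ := exists_shadow_subset hT κ r hU hrU
    rw [hx] at hN
    exact ⟨N, fun w hw => fixes_branch_of_fixes_shadow hT hΩ (fun ξ hξ => hg ξ (hN hξ)) hw⟩
  · rintro ⟨N, hN⟩
    refine ⟨shadow T (r.vert N) (κ.step (r.vert N) (x N)), ?_, ?_, fun ξ hξ =>
      fixes_shadow_of_fixes_branch hT hN hξ⟩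
    · exact TopologicalSpace.isOpen_generateFrom_of_mem ⟨_, _, κ.adj_step _ _, rfl⟩
    · exact (mk_mem_shadow_iff hT).mpr ⟨N + 1, fun j hj => Ray.vert_mem_branch hT hx (by omega)⟩

end TreeBoundary

/-! ### Colour permutations -/

section Permutations

variable {Ω : Type u} {F F' : Subgroup (Equiv.Perm Ω)}

theorem exists_perm_apply_eq_self_apply_ne [Finite Ω] (hFF' : F ≤ F') (hF : IsSimplyTransitive F)
    {a c : Ω} (hac : MulAction.stabilizer F' a ≠ MulAction.stabilizer F' c) :
    ∃ σ ∈ F', σ a = a ∧ σ c ≠ c := by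
  by_contra! hcon
  obtain ⟨f, hf, -⟩ := hF a c
  let f' : F' := ⟨f, hFF' f.2⟩
  have hfa : f' • a = c := hf
  refine hac (Subgroup.eq_of_le_of_card_ge (fun σ hσ => hcon σ σ.2 hσ) ?_)
  -- the stabilisers are conjugate, so they have the same finite order
  rw [← hfa, MulAction.stabilizer_smul_eq_stabilizer_map_conj]
  exact (Subgroup.card_map_of_injective (MulAut.conj f').injective).le

theorem exists_perm_fixing_ne_one (hFF' : F ≤ F') (hF : IsSimplyTransitive F) {σ : Equiv.Perm Ω}
    (hσ : σ ∈ F') {a c : Ω} (ha : σ a = a) (hc : σ c ≠ c) (y : Ω) :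
    ∃ τ ∈ F', τ y = y ∧ ∃ z, τ z ≠ z := by
  obtain ⟨f, rfl, -⟩ := hF a y
  have hf := hFF' f.2
  refine ⟨f * σ * f⁻¹, F'.mul_mem (F'.mul_mem hf hσ) (F'.inv_mem hf), by simp [ha],
    (f : Equiv.Perm Ω) c, by simpa using hc⟩

theorem exists_two_colours [Finite Ω] (hFF' : F ≤ F') (hF : IsSimplyTransitive F) {a b c : Ω}
    (hne : a ≠ b) (hab : MulAction.stabilizer F' a = MulAction.stabilizer F' b)
    (hac : MulAction.stabilizer F' a ≠ MulAction.stabilizer F' c) (y z : Ω) :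
    ∃ y₁ y₂, y₁ ≠ y₂ ∧ y₁ ≠ y ∧ y₁ ≠ z ∧ y₂ ≠ y ∧ y₂ ≠ z := by
  classical
  have := Fintype.ofFinite Ω
  obtain ⟨f, hf, -⟩ := hF a c
  let f' : F' := ⟨f, hFF' f.2⟩
  have hfa : f' • a = c := hf
  -- the image of `b` is a fourth colour, with the same stabiliser as `c`
  have he : MulAction.stabilizer F' (f' • b) = MulAction.stabilizer F' c := by
    rw [← hfa, MulAction.stabilizer_smul_eq_stabilizer_map_conj, ← hab,
      MulAction.stabilizer_smul_eq_stabilizer_map_conj]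
  have hec : f' • b ≠ c := fun h => hne (smul_left_cancel f' (hfa.trans h.symm))
  have hea : f' • b ≠ a := fun h => hac (by rw [← he, h])
  have heb : f' • b ≠ b := fun h => hac (by rw [hab, ← he, h])
  have hca : c ≠ a := by rintro rfl; exact hac rfl
  have hcb : c ≠ b := by rintro rfl; exact hac hab
  have h4 : ({a, b, c, f' • b} : Finset Ω).card = 4 := by
    rw [Finset.card_insert_of_notMem, Finset.card_insert_of_notMem, Finset.card_pair hec.symm]
    · simp [hcb.symm, heb.symm]
    · simp [hne, hca.symm, hea.symm]
  have h2 := Finset.le_card_sdiff {y, z} ({a, b, c, f' • b} : Finset Ω)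
  have h3 := Finset.card_le_two (a := y) (b := z)
  obtain ⟨y₁, h1, y₂, h2, h12⟩ := Finset.one_lt_card.mp
    (show 1 < (({a, b, c, f' • b} : Finset Ω) \ {y, z}).card by omega)
  simp only [Finset.mem_sdiff, Finset.mem_insert, Finset.mem_singleton, not_or] at h1 h2
  exact ⟨y₁, y₂, h12, h1.2.1, h1.2.2, h2.2.1, h2.2.2⟩

end Permutations

/-! ### Direct products and groups acting on a tree -/

theorem IsNontrivialDirectProduct.of_mulEquiv {A B : Type*} [Group A] [Group B] (e : A ≃* B)
    (h : IsNontrivialDirectProduct A) : IsNontrivialDirectProduct B := by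
  obtain ⟨H, K, hH, hK, hHn, hKn, hc⟩ := h
  refine ⟨e.mapSubgroup H, e.mapSubgroup K, ?_, ?_, hHn.map _ e.surjective, hKn.map _ e.surjective,
    e.mapSubgroup.isCompl hc⟩
  · rwa [Ne, map_eq_bot_iff]
  · rwa [Ne, map_eq_bot_iff]

section Displacement

variable {V : Type v} {T : SimpleGraph V}

/-- The subgroup of all automorphisms of `T` that fix every vertex in `A`. -/
def vertexFixer (T : SimpleGraph V) (A : Set V) : Subgroup (T ≃g T) where
  carrier := {g | ∀ w ∈ A, g w = w}
  one_mem' _ _ := rfl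
  mul_mem' {g h} hg hh w hw := by
    rw [RelIso.mul_apply, hh w hw, hg w hw]
  inv_mem' {g} hg w hw := by
    conv_lhs => rw [← hg w hw]
    exact RelIso.inv_apply_self g w

/-- If `h` moves the support of `u` off itself, then the commutator of `h` and `u` acts as `u⁻¹` on
this support. -/
theorem commutator_apply_of_displaced {h u : T ≃g T} {Z : Set V} (hu : u ∈ vertexFixer T Zᶜ)
    (hh : ∀ z ∈ Z, h z ∉ Z) {z : V} (hz : z ∈ Z) :
    (h * u * h⁻¹ * u⁻¹) z = u⁻¹ z ∧ u⁻¹ z ∈ Z := by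
  have h1 : u⁻¹ z ∈ Z := by
    by_contra hcon
    have := hu _ hcon
    rw [RelIso.apply_inv_self] at this
    exact hcon (this ▸ hz)
  refine ⟨?_, h1⟩
  have h2 : h⁻¹ (u⁻¹ z) ∉ Z := fun hcon => hh _ hcon (by rwa [RelIso.apply_inv_self])
  rw [RelIso.mul_apply, RelIso.mul_apply, RelIso.mul_apply, hu _ h2, RelIso.apply_inv_self]

theorem commute_of_displaced {h k u t : T ≃g T} {Z : Set V} (hu : u ∈ vertexFixer T Zᶜ)
    (ht : t ∈ vertexFixer T Zᶜ) (hh : ∀ z ∈ Z, h z ∉ Z) (hk : ∀ z ∈ Z, k z ∉ Z)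
    (hc : Commute (h * u * h⁻¹ * u⁻¹) (k * t * k⁻¹ * t⁻¹)) : Commute u t := by
  rw [← Commute.inv_inv_iff]
  refine RelIso.ext fun z => ?_
  by_cases hz : z ∈ Z
  · obtain ⟨h1, h2⟩ := commutator_apply_of_displaced ht hk hz
    obtain ⟨h3, h4⟩ := commutator_apply_of_displaced hu hh hz
    have := DFunLike.congr_fun hc.eq z
    rw [RelIso.mul_apply, RelIso.mul_apply (k * t * k⁻¹ * t⁻¹), h1, h3] at this
    rwa [(commutator_apply_of_displaced hu hh h2).1,
      (commutator_apply_of_displaced ht hk h4).1] at this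
  · have h1 := (vertexFixer T Zᶜ).inv_mem hu z hz
    have h2 := (vertexFixer T Zᶜ).inv_mem ht z hz
    rw [RelIso.mul_apply, RelIso.mul_apply, h1, h2, h1]

end Displacement

/-! ### A neighbourhood stabiliser that splits -/

namespace LegalColouring

open TreeBoundary

variable {V : Type v} {T : SimpleGraph V} {Ω : Type u} {κ : LegalColouring T Ω}

/-- An element fixing the edge of colour `x` at `v` is split by replacing its action on the branch
in the direction `x` by the identity; this does not create new non-trivial local actions. -/
theorem exists_trivial_on_branch (hT : T.IsTree) {F F' : Subgroup (Equiv.Perm Ω)} {g : T ≃g T}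
    (hg : g ∈ κ.almostPrescribed F F') {v : V} {x : Ω} (hv : g v = v)
    (hx : g (κ.step v x) = κ.step v x) :
    ∃ g' ∈ κ.almostPrescribed F F', (∀ w ∈ κ.branch v x, g' w = w) ∧
      ∀ w, w ∉ κ.branch v x → g' w = g w := by
  classical
  have hσx : κ.localAction g v x = x := κ.localAction_apply_eq (by rw [hx, hv])
  obtain ⟨g', hv', hb, hl, hlb⟩ := κ.exists_glue hT v (fun y => if y = x then 1 else g)
    (κ.localAction g v) (fun y => by split_ifs <;> simp [hv]) (fun y => by
      split_ifs with h
      · rw [localAction_one, h, hσx]; rfl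
      · rfl)
  have hloc : ∀ w, κ.localAction g' w = κ.localAction g w ∨ κ.localAction g' w = 1 := fun w => by
    by_cases hw : w = v
    · exact Or.inl (by rw [hw, hl])
    · obtain ⟨y, hy⟩ := κ.exists_mem_branch hT hw
      rw [hlb y w hy]
      split_ifs
      · exact Or.inr (localAction_one κ w)
      · exact Or.inl rfl
  refine ⟨g', ⟨fun w => ?_, hg.2.subset fun w hw => ?_⟩, fun w hw => ?_, fun w hw => ?_⟩
  · rcases hloc w with h | h <;> rw [h]
    · exact hg.1 w
    · exact F'.one_mem
  · rcases hloc w with h | h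
    · rwa [Set.mem_ofPred_eq, h] at hw
    · rw [Set.mem_ofPred_eq, h] at hw
      exact absurd F.one_mem hw
  · rw [hb x w hw, if_pos rfl]
    rfl
  · by_cases hwv : w = v
    · rw [hwv, hv', hv]
    · obtain ⟨y, hy⟩ := κ.exists_mem_branch hT hwv
      rw [hb y w hy, if_neg]
      rintro rfl
      exact hw hy

variable {F F' : Subgroup (Equiv.Perm Ω)} {r : Ray T} {x : ℕ → Ω}

/-- If all permutations in `F'` fixing a colour of the ray also fix the preceding one, then an
element of the neighbourhood stabiliser of its endpoint fixes the whole ray. -/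
theorem fixes_ray (hT : T.IsTree) (hx : ∀ n, r.vert (n + 1) = κ.step (r.vert n) (x n))
    (hstab : ∀ σ ∈ F', ∀ n, σ (x (n + 1)) = x (n + 1) → σ (x n) = x n) {g : T ≃g T}
    (hg : g ∈ κ.almostPrescribed F F') {N : ℕ} (hN : ∀ w ∈ κ.branch (r.vert N) (x N), g w = w)
    (n : ℕ) : g (r.vert n) = r.vert n := by
  have key : ∀ k n, N + 1 ≤ n + k → g (r.vert n) = r.vert n := by
    intro k
    induction k with
    | zero => exact fun n hn => hN _ (Ray.vert_mem_branch hT hx (by omega))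
    | succ k ih =>
      intro n hn
      have h1 := ih (n + 1) (by omega)
      have h2 := ih (n + 2) (by omega)
      have h3 : κ.localAction g (r.vert (n + 1)) (x (n + 1)) = x (n + 1) :=
        κ.localAction_apply_eq (by rw [← hx, h1, h2, ← hx])
      have h4 := hstab _ (hg.1 _) n h3
      have h5 := κ.map_step g (r.vert (n + 1)) (x n)
      rwa [h4, h1, hx, step_step] at h5
  exact key (N + 1) n (by omega)

/-- The neighbourhood stabiliser fixes the first edge of the ray and is the direct product of its
subgroups fixing pointwise the one or the other half of the tree without this edge. -/
theorem isNontrivialDirectProduct_neighbourhoodStabiliser (hT : T.IsTree) (hFF' : F ≤ F')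
    (hF : IsSimplyTransitive F)
    (hΩ : ∀ y z : Ω, ∃ y₁ y₂, y₁ ≠ y₂ ∧ y₁ ≠ y ∧ y₁ ≠ z ∧ y₂ ≠ y ∧ y₂ ≠ z)
    (hx : ∀ n, r.vert (n + 1) = κ.step (r.vert n) (x n))
    (hstab : ∀ σ ∈ F', ∀ n, σ (x (n + 1)) = x (n + 1) ↔ σ (x n) = x n) {σ : Equiv.Perm Ω}
    (hσ : σ ∈ F') (hσx : σ (x 0) = x 0) {c : Ω} (hσc : σ c ≠ c) :
    IsNontrivialDirectProduct
      (neighbourhoodStabiliser (κ.almostPrescribed F F') (Boundary.mk r)) := by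
  set S := neighbourhoodStabiliser (κ.almostPrescribed F F') (Boundary.mk r)
  have hmem : ∀ g, g ∈ S ↔ ∃ N, ∀ w ∈ κ.branch (r.vert N) (x N), (g : T ≃g T) w = w := fun g =>
    mem_neighbourhoodStabiliser_iff hT hΩ hx
  have hfix : ∀ (g : S) (n : ℕ), g.1.1 (r.vert n) = r.vert n := fun g n => by
    obtain ⟨N, hN⟩ := (hmem g.1).mp g.2
    exact fixes_ray hT hx (fun σ hσ n => (hstab σ hσ n).mp) g.1.2 hN n
  have hcompl : ∀ w, w ∈ κ.branch (r.vert 1) (x 0) ↔ w ∉ κ.branch (r.vert 0) (x 0) := fun w => by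
    rw [hx 0]
    exact mem_branch_step_iff hT
  have hinv : ∀ (g : S), ∀ w ∈ κ.branch (r.vert 0) (x 0), g.1.1 w ∈ κ.branch (r.vert 0) (x 0) :=
    fun g w hw => map_mem_branch_of_fixed (hfix g 0) (by rw [← hx]; exact hfix g 1) hw
  have hinv' : ∀ (g : S), ∀ w ∈ κ.branch (r.vert 1) (x 0), g.1.1 w ∈ κ.branch (r.vert 1) (x 0) :=
    fun g w hw => map_mem_branch_of_fixed (hfix g 1)
      (by rw [hx 0, step_step]; exact hfix g 0) hw
  let ι : S →* (T ≃g T) := (κ.almostPrescribed F F').subtype.comp S.subtype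
  have hnormal : ∀ A : Set V, (∀ (g : S), ∀ w ∈ A, g.1.1 w ∈ A) →
      ((vertexFixer T A).comap ι).Normal := fun A hA => ⟨fun h hh g w hw => by
    have h1 := hh _ (hA g⁻¹ w hw)
    change g.1.1 (h.1.1 (g⁻¹.1.1 w)) = w
    exact (congrArg _ h1).trans (RelIso.apply_inv_self g.1.1 w)⟩
  refine ⟨(vertexFixer T (κ.branch (r.vert 0) (x 0))).comap ι,
    (vertexFixer T (κ.branch (r.vert 1) (x 0))).comap ι, ?_, ?_, hnormal _ hinv, hnormal _ hinv',
    ?_, ?_⟩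
  · obtain ⟨g, hg, -, hgs, hgb⟩ := κ.exists_almostPrescribed hT hFF' hF (r.vert 0) hσ
    have h1 := hgb _ hσx
    intro hbot
    have h2 : (⟨⟨g, hg⟩, (hmem _).mpr ⟨0, h1⟩⟩ : S) = 1 := Subgroup.mem_bot.mp (hbot ▸ h1)
    have h3 : g = 1 := congrArg (fun s : S => s.1.1) h2
    refine hσc ((κ.step_inj (v := r.vert 0)).mp ?_)
    rw [← hgs, h3]
    rfl
  · obtain ⟨g, hg, -, hgs, hgb⟩ := κ.exists_almostPrescribed hT hFF' hF (r.vert 1) hσ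
    have h1 := hgb _ hσx
    intro hbot
    have h2 : (⟨⟨g, hg⟩, (hmem _).mpr ⟨1, hgb _ ((hstab σ hσ 0).mpr hσx)⟩⟩ : S) = 1 :=
      Subgroup.mem_bot.mp (hbot ▸ h1)
    have h3 : g = 1 := congrArg (fun s : S => s.1.1) h2
    refine hσc ((κ.step_inj (v := r.vert 1)).mp ?_)
    rw [← hgs, h3]
    rfl
  · rw [Subgroup.disjoint_def]
    intro g hg hg'
    refine Subtype.ext (Subtype.ext (RelIso.ext fun w => ?_))
    by_cases hw : w ∈ κ.branch (r.vert 0) (x 0)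
    · exact hg w hw
    · exact hg' w ((hcompl w).mpr hw)
  · rw [codisjoint_iff, eq_top_iff]
    intro g _
    obtain ⟨g', hg', hgb, hgc⟩ := exists_trivial_on_branch hT g.1.2 (hfix g 0)
      (by rw [← hx]; exact hfix g 1)
    let k : S := ⟨⟨g', hg'⟩, (hmem _).mpr ⟨0, hgb⟩⟩
    have hk : g * k⁻¹ ∈ (vertexFixer T (κ.branch (r.vert 1) (x 0))).comap ι := by
      intro w hw
      -- `k` and `g` agree at `k⁻¹ w`
      have h1 : k.1.1 (k⁻¹.1.1 w) = g.1.1 (k⁻¹.1.1 w) :=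
        hgc _ ((hcompl _).mp (hinv' k⁻¹ w hw))
      exact h1.symm.trans (RelIso.apply_inv_self g' w)
    have hk' : k ∈ (vertexFixer T (κ.branch (r.vert 0) (x 0))).comap ι := hgb
    rw [← inv_mul_cancel_right g k]
    exact Subgroup.mul_mem _ (Subgroup.mem_sup_right hk) (Subgroup.mem_sup_left hk')

/-! ### A neighbourhood stabiliser that does not split -/

/-- The group of elements of `G(F, F')` supported on a branch is not commutative. -/
theorem exists_not_commute (hT : T.IsTree) (hFF' : F ≤ F') (hF : IsSimplyTransitive F)
    (hfix : ∀ y, ∃ σ ∈ F', σ y = y ∧ ∃ z, σ z ≠ z) (v : V) (y : Ω) :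
    ∃ u ∈ κ.almostPrescribed F F', ∃ t ∈ κ.almostPrescribed F F',
      u ∈ vertexFixer T (κ.branch v y)ᶜ ∧ t ∈ vertexFixer T (κ.branch v y)ᶜ ∧ ¬ Commute u t := by
  have hcompl : ∀ w ∈ (κ.branch v y)ᶜ, w ∈ κ.branch (κ.step v y) y := fun w hw =>
    (mem_branch_step_iff hT).mpr hw
  generalize κ.step v y = p at hcompl
  obtain ⟨σ, hσ, hσy, z, hσz⟩ := hfix y
  obtain ⟨τ, hτ, hτz, q, hτq⟩ := hfix z
  -- `u` moves the branch at `p` in the direction `z` off itself, and `t` is supported on it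
  obtain ⟨u, hu, hup, hus, hub⟩ := κ.exists_almostPrescribed hT hFF' hF p hσ
  obtain ⟨t, ht, -, hts, htb⟩ := κ.exists_almostPrescribed hT hFF' hF (κ.step p z) hτ
  have hyz : y ≠ z := by rintro rfl; exact hσz hσy
  have hqz : q ≠ z := by rintro rfl; exact hτq hτz
  refine ⟨u, hu, t, ht, fun w hw => hub y hσy w (hcompl w hw), fun w hw => htb z hτz w ?_, ?_⟩
  · rw [mem_branch_step_iff hT]
    exact fun hz => hyz (branch_disjoint hT (hcompl w hw) hz)
  · intro hc
    have h1 : κ.step (κ.step p z) q ∈ κ.branch p z :=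
      branch_step_subset hT hqz (κ.step_mem_branch _ _)
    have h2 := map_notMem_branch hT hup (by rwa [hus, Ne, step_inj]) h1
    have h3 := htb z hτz _ ((mem_branch_step_iff hT).mpr h2)
    have h4 := DFunLike.congr_fun hc.eq (κ.step (κ.step p z) q)
    rw [RelIso.mul_apply, RelIso.mul_apply, h3, u.injective.eq_iff, hts, step_inj] at h4
    exact hτq h4

/-- A non-trivial automorphism with a fixed vertex moves a whole branch off itself. -/
theorem exists_displaced_branch (hT : T.IsTree) (κ : LegalColouring T Ω) {g : T ≃g T} {v : V}
    (hv : g v = v) (hg : g ≠ 1) : ∃ p y, g p = p ∧ g (κ.step p y) ≠ κ.step p y := by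
  by_contra! hcon
  refine hg (RelIso.ext fun w => ?_)
  obtain ⟨p⟩ := hT.1.preconnected v w
  induction p with
  | nil => exact hv
  | cons h p ih =>
    obtain ⟨y, rfl⟩ := κ.exists_eq_step h
    exact ih (hcon _ y hv)

/-- If `g` fixes the branch at the `L`-th vertex of a ray that contains its tail, but moves the
`N`-th vertex, then it moves the complement of the branch at the `N`-th vertex into that branch. -/
theorem map_mem_branch_of_moves_vert (hT : T.IsTree)
    (hx : ∀ n, r.vert (n + 1) = κ.step (r.vert n) (x n)) {g : T ≃g T} {L N : ℕ}
    (hL : ∀ w ∈ κ.branch (r.vert L) (x L), g w = w) (hN : g (r.vert N) ≠ r.vert N) {z : V}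
    (hz : z ∉ κ.branch (r.vert N) (x N)) : g z ∈ κ.branch (r.vert N) (x N) := by
  -- the last vertex moved by `g`
  obtain ⟨M, hNM, hM, hM1⟩ : ∃ M, N ≤ M ∧ g (r.vert M) ≠ r.vert M ∧
      g (r.vert (M + 1)) = r.vert (M + 1) := by
    by_contra! hcon
    have : ∀ n, N ≤ n → g (r.vert n) ≠ r.vert n := fun n hn =>
      Nat.le_induction hN (fun m hm h => hcon m hm h) n hn
    exact this (N + L + 1) (by omega) (hL _ (Ray.vert_mem_branch hT hx (by omega)))
  have hsub := Ray.branch_antitone hT hx hNM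
  have hz' : z ∈ κ.branch (r.vert (M + 1)) (x M) := by
    rw [hx, mem_branch_step_iff hT]
    exact fun h => hz (hsub h)
  have h1 := map_notMem_branch hT hM1 (by rwa [hx M, step_step]) hz'
  rw [hx M, mem_branch_step_iff hT, not_not] at h1
  exact hsub h1

/-- If every two consecutive colours of a ray are separated by a permutation in `F'` fixing the
second one, then the neighbourhood stabiliser of its endpoint is not a direct product: one of the
factors would move a vertex far out on the ray, and hence move off itself a branch that is moved
off itself by the other factor as well. -/
theorem not_isNontrivialDirectProduct_neighbourhoodStabiliser (hT : T.IsTree) (hFF' : F ≤ F')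
    (hF : IsSimplyTransitive F)
    (hΩ : ∀ y z : Ω, ∃ y₁ y₂, y₁ ≠ y₂ ∧ y₁ ≠ y ∧ y₁ ≠ z ∧ y₂ ≠ y ∧ y₂ ≠ z)
    (hfix : ∀ y, ∃ σ ∈ F', σ y = y ∧ ∃ z, σ z ≠ z)
    (hx : ∀ n, r.vert (n + 1) = κ.step (r.vert n) (x n))
    (hsep : ∀ n, ∃ σ ∈ F', σ (x (n + 1)) = x (n + 1) ∧ σ (x n) ≠ x n) :
    ¬ IsNontrivialDirectProduct
      (neighbourhoodStabiliser (κ.almostPrescribed F F') (Boundary.mk r)) := by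
  set S := neighbourhoodStabiliser (κ.almostPrescribed F F') (Boundary.mk r)
  have hmem : ∀ g, g ∈ S ↔ ∃ N, ∀ w ∈ κ.branch (r.vert N) (x N), (g : T ≃g T) w = w := fun g =>
    mem_neighbourhoodStabiliser_iff hT hΩ hx
  rintro ⟨H, K, hH, hK, hHn, hKn, hHK⟩
  obtain ⟨h₀, hh₀, hh₁⟩ := H.bot_or_exists_ne_one.resolve_left hH
  obtain ⟨k₀, hk₀, hk₁⟩ := K.bot_or_exists_ne_one.resolve_left hK
  obtain ⟨N₁, hN₁⟩ := (hmem _).mp h₀.2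
  obtain ⟨N₂, hN₂⟩ := (hmem _).mp k₀.2
  obtain ⟨N, h₁, h₂⟩ : ∃ N, N₁ ≤ N ∧ N₂ ≤ N := ⟨max N₁ N₂, le_max_left _ _, le_max_right _ _⟩
  replace hN₁ := fun w hw => hN₁ w (Ray.branch_antitone hT hx h₁ hw)
  replace hN₂ := fun w hw => hN₂ w (Ray.branch_antitone hT hx h₂ hw)
  -- no branch is moved off itself by both factors, as elements supported on it would commute
  have hnot : ∀ p y, (∀ z ∈ κ.branch p y, z ∉ κ.branch (r.vert N) (x N)) → ∀ h ∈ H, ∀ k ∈ K,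
      (∀ z ∈ κ.branch p y, h.1.1 z ∉ κ.branch p y) →
      (∀ z ∈ κ.branch p y, k.1.1 z ∉ κ.branch p y) → False := by
    intro p y hZ h hh k hk hhZ hkZ
    obtain ⟨u, hu, t, ht, hu', ht', hut⟩ := κ.exists_not_commute hT hFF' hF hfix p y
    let u₁ : S := ⟨⟨u, hu⟩, (hmem _).mpr ⟨N, fun w hw => hu' w fun hwZ => hZ w hwZ hw⟩⟩
    let t₁ : S := ⟨⟨t, ht⟩, (hmem _).mpr ⟨N, fun w hw => ht' w fun hwZ => hZ w hwZ hw⟩⟩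
    have hH' : h * u₁ * h⁻¹ * u₁⁻¹ ∈ H := by
      rw [mul_assoc, mul_assoc, ← mul_assoc u₁]
      exact H.mul_mem hh (hHn.conj_mem _ (H.inv_mem hh) u₁)
    have hK' : k * t₁ * k⁻¹ * t₁⁻¹ ∈ K := by
      rw [mul_assoc, mul_assoc, ← mul_assoc t₁]
      exact K.mul_mem hk (hKn.conj_mem _ (K.inv_mem hk) t₁)
    have hc := Subgroup.commute_of_normal_of_disjoint H K hHn hKn hHK.disjoint _ _ hH' hK'
    exact hut (commute_of_displaced hu' ht' hhZ hkZ (congrArg (fun s : S => s.1.1) hc.eq))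
  have hdispl : ∀ g : S, g ≠ 1 → (∀ w ∈ κ.branch (r.vert N) (x N), g.1.1 w = w) →
      ∃ p y, (∀ z ∈ κ.branch p y, z ∉ κ.branch (r.vert N) (x N)) ∧
        ∀ z ∈ κ.branch p y, g.1.1 z ∉ κ.branch p y := by
    intro g hg hgN
    obtain ⟨p, y, hp, hy⟩ := exists_displaced_branch hT κ
      (hgN _ (Ray.vert_mem_branch hT hx (Nat.lt_succ_self N)))
      (fun h => hg (Subtype.ext (Subtype.ext h)))
    have h := fun z => map_notMem_branch hT (w := z) hp hy
    exact ⟨p, y, fun z hz hzN => h z hz ((hgN z hzN).symm ▸ hz), h⟩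
  have hmoves : ∀ q : S, q.1.1 (r.vert N) ≠ r.vert N → ∀ p y,
      (∀ z ∈ κ.branch p y, z ∉ κ.branch (r.vert N) (x N)) →
      ∀ z ∈ κ.branch p y, q.1.1 z ∉ κ.branch p y := by
    intro q hq p y hZ z hz hqz
    obtain ⟨L, hL⟩ := (hmem _).mp q.2
    exact hZ _ hqz (map_mem_branch_of_moves_vert hT hx hL hq (hZ z hz))
  let ι : S →* (T ≃g T) := (κ.almostPrescribed F F').subtype.comp S.subtype
  have hsup : ¬ H ⊔ K ≤ (vertexFixer T {r.vert N}).comap ι := by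
    obtain ⟨σ, hσ, hσ₁, hσ₀⟩ := hsep N
    obtain ⟨g, hg, hgv, hgs, hgb⟩ := κ.exists_almostPrescribed hT hFF' hF (r.vert (N + 1)) hσ
    intro hle
    have hgS : (⟨⟨g, hg⟩, (hmem _).mpr ⟨N + 1, hgb _ hσ₁⟩⟩ : S) ∈ H ⊔ K :=
      hHK.sup_eq_top ▸ Subgroup.mem_top _
    have h1 : g (r.vert N) = r.vert N := hle hgS _ rfl
    have h2 : κ.step (r.vert (N + 1)) (x N) = r.vert N := by rw [hx, step_step]
    have h3 := hgs (x N)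
    rw [h2, h1, ← h2, step_inj] at h3
    exact hσ₀ h3.symm
  rw [sup_le_iff, not_and_or, SetLike.not_le_iff_exists, SetLike.not_le_iff_exists] at hsup
  have hmem_fixer : ∀ q : S, q.1.1 (r.vert N) = r.vert N →
      q ∈ (vertexFixer T {r.vert N}).comap ι := fun q hq w hw => by
    rw [Set.mem_singleton_iff.mp hw]
    exact hq
  rcases hsup with ⟨h, hh, hhN⟩ | ⟨k, hk, hkN⟩
  · obtain ⟨p, y, hZ, hkZ⟩ := hdispl k₀ hk₁ hN₂
    exact hnot p y hZ h hh k₀ hk₀ (hmoves h (fun hq => hhN (hmem_fixer h hq)) p y hZ) hkZ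
  · obtain ⟨p, y, hZ, hhZ⟩ := hdispl h₀ hh₁ hN₁
    exact hnot p y hZ h₀ hh₀ k hk hhZ (hmoves k (fun hq => hkN (hmem_fixer k hq)) p y hZ)

end LegalColouring

/-! ### The two boundary points -/

theorem mainTheorem6 {Ω : Type u} [Finite Ω] (F F' : Subgroup (Equiv.Perm Ω)) (hFF' : F ≤ F')
    (hF : IsSimplyTransitive F) {a b c : Ω} (hne : a ≠ b)
    (hab : MulAction.stabilizer F' a = MulAction.stabilizer F' b)
    (hac : MulAction.stabilizer F' a ≠ MulAction.stabilizer F' c)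
    {V : Type v} (T : SimpleGraph V) (hT : T.IsTree) (κ : LegalColouring T Ω) :
    ∃ ξ η : TreeBoundary.Boundary T,
      IsEmpty (neighbourhoodStabiliser (κ.almostPrescribed F F') ξ ≃*
        neighbourhoodStabiliser (κ.almostPrescribed F F') η) ∧
      IsNontrivialDirectProduct (neighbourhoodStabiliser (κ.almostPrescribed F F') ξ) ∧
      ¬ IsNontrivialDirectProduct (neighbourhoodStabiliser (κ.almostPrescribed F F') η) := by
  obtain ⟨v⟩ := hT.1.nonempty
  have hne' : a ≠ c := by rintro rfl; exact hac rfl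
  have hΩ := exists_two_colours hFF' hF hne hab hac
  obtain ⟨σ, hσ, hσa, hσc⟩ := exists_perm_apply_eq_self_apply_ne hFF' hF hac
  obtain ⟨τ, hτ, hτc, hτa⟩ := exists_perm_apply_eq_self_apply_ne hFF' hF hac.symm
  obtain ⟨r, -, hr⟩ := TreeBoundary.exists_alternating_ray hT κ v hne
  obtain ⟨s, -, hs⟩ := TreeBoundary.exists_alternating_ray hT κ v hne'
  have hstab : ∀ ρ ∈ F', (ρ a = a ↔ ρ b = b) := fun ρ hρ => by
    have := SetLike.ext_iff.mp hab ⟨ρ, hρ⟩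
    exact this
  have hξ := LegalColouring.isNontrivialDirectProduct_neighbourhoodStabiliser hT hFF' hF hΩ hr
    (fun ρ hρ n => by
      by_cases hn : Even n
      · simpa [hn, Nat.even_add_one] using (hstab ρ hρ).symm
      · simpa [hn, Nat.even_add_one] using hstab ρ hρ) hσ (by simpa using hσa) hσc
  have hη := LegalColouring.not_isNontrivialDirectProduct_neighbourhoodStabiliser hT hFF' hF hΩ
    (exists_perm_fixing_ne_one hFF' hF hσ hσa hσc) hs (fun n => by
      by_cases hn : Even n
      · exact ⟨τ, hτ, by simpa [hn, Nat.even_add_one] using ⟨hτc, hτa⟩⟩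
      · exact ⟨σ, hσ, by simpa [hn, Nat.even_add_one] using ⟨hσa, hσc⟩⟩)
  exact ⟨_, _, ⟨fun e => hη (hξ.of_mulEquiv e)⟩, hξ, hη⟩
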